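/- Let $d,n\in\mathbb{N}=\{0,1,2,\dots\}$ and $f\in L^2(\mathbb{R}^d)$. Let $$Wf(x,\omega)=\int_{\mathbb{R}^d}e^{-2\pi i\,\omega\cdot y}\,f(x+\tfrac12 y)\,\overline{f(x-\tfrac12 y)}\,dy,\qquad (x,\omega)\in\mathbb{R}^{2d},$$ be the Wigner distribution of $f$, let $\Theta^n(x,\omega)=\mathrm{sinc}^n(x\cdot\omega)$, where $\mathrm{sinc}(t)=\frac{\sin(\pi t)}{\pi t}$ for $t\neq0$ and $\mathrm{sinc}(0)=1$, and let $$Q^nf=Wf*\mathcal{F}_\sigma(\Theta^n)$$ be the Born-Jordan distribution of order $n$ of $f$. Here $\mathcal{F}_\sigma F(\zeta)=\int_{\mathbb{R}^{2d}}e^{-2\pi i\,J\zeta\cdot z}F(z)\,dz$ with $J(\zeta_1,\zeta_2)=(\zeta_2,-\zeta_1)$ is the symplectic Fourier transform, extended to tempered distributions, and the convolution is the tempered distribution given on Schwartz functions by $\langle Wf*\theta,\varphi\rangle=\int_{\mathbb{R}^{2d}}Wf(z)\,\langle\theta,\varphi(z+\cdot)\rangle\,dz$ (bilinear pairings). For $s\in\mathbb{R}$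 and a tempered distribution $u$ on $\mathbb{R}^N$, the Sobolev wave-front set $WF_{H^s}(u)\subset\mathbb{R}^N\times(\mathbb{R}^N\setminus\{0\})$ is the set of the points $(x_0,\xi_0)$ with $\xi_0\neq0$ for which the following does not hold: for some $\varphi\in C_c^\infty(\mathbb{R}^N)$ with $\varphi(x_0)\neq0$ and some open conic neighbourhood $\Gamma\subset\mathbb{R}^N\setminus\{0\}$ of $\xi_0$, $$\big\|\mathcal{F}[\varphi u](\xi)\,(1+|\xi|^2)^{s/2}\big\|_{L^2(\Gamma)}<\infty,$$ where $\mathcal{F}$ is the Fourier transform $\mathcal{F}g(\xi)=\int e^{-2\pi i\,\xi\cdot x}g(x)\,dx$, extended to tempered distributions. Then $Wf\in L^2(\mathbb{R}^{2d})$, the distribution $Q^nf\in\mathcal{S}'(\mathbb{R}^{2d})$ is well defined, and for all $z\in\mathbb{R}^{2d}$ and all $\zeta=(\zeta_1,\zeta_2)\in\mathbb{R}^d\times\mathbb{R}^d$ with $\zeta_1\cdot\zeta_2\neq0$, $$(z,\zeta)\notin WF_{H^{2n}}(Q^nf),$$ that is, $Q^nf$ has regularity $H^{2n}$ at $z$ in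 the direction $\zeta$. -/

import Mathlib

open MeasureTheory SchwartzMap
open scoped FourierTransform ContDiff

noncomputable section

/-- The configuration space `ℝ^d`. -/
abbrev Config (d : ℕ) : Type := EuclideanSpace ℝ (Fin d)

/-- The phase space `ℝ^{2d} = ℝ^d × ℝ^d`, with its Euclidean structure. Its points are
`z = (x, ω)`, with `x = z.fst` and `ω = z.snd`. -/
abbrev Phase (d : ℕ) : Type := WithLp 2 (Config d × Config d)

/-- The Wigner distribution
`W f (x, ω) = ∫ exp (-2πi y·ω) f (x + y/2) conj (f (x - y/2)) dy`. -/
def wigner {d : ℕ} (f : Config d → ℂ) (z : Phase d) : ℂ :=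
  ∫ y : Config d, Complex.exp (-2 * Real.pi * Complex.I * (inner ℝ y z.snd : ℝ)) *
    f (z.fst + (1 / 2 : ℝ) • y) * (starRingEnd ℂ) (f (z.fst - (1 / 2 : ℝ) • y))

/-- The map `J (x, ω) = (ω, -x)` of the phase space. -/
def symplecticJ (d : ℕ) : Phase d ≃L[ℝ] Phase d :=
  (WithLp.prodContinuousLinearEquiv 2 ℝ (Config d) (Config d)).trans
    (((ContinuousLinearEquiv.prodComm ℝ (Config d) (Config d)).trans
      ((ContinuousLinearEquiv.refl ℝ (Config d)).prodCongr
        (ContinuousLinearEquiv.neg ℝ (M := Config d)))).trans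
    (WithLp.prodContinuousLinearEquiv 2 ℝ (Config d) (Config d)).symm)

theorem symplecticJ_apply (d : ℕ) (z : Phase d) :
    symplecticJ d z = WithLp.toLp 2 (z.snd, -z.fst) := rfl

/-- The symplectic Fourier transform of a tempered distribution on the phase space,
`𝓕_σ u = (𝓕 u) ∘ J`; for an integrable function `F` it is
`𝓕_σ F (ζ) = ∫ exp (-2πi σ(ζ, z)) F z dz` with `σ(ζ, z) = J ζ · z`. Composition with `J` is
defined by duality, `⟨v ∘ J, φ⟩ = ⟨v, φ ∘ J⁻¹⟩`, since `det J = 1`. -/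
def symplecticFourier {d : ℕ} (u : 𝓢'(Phase d, ℂ)) : 𝓢'(Phase d, ℂ) :=
  PointwiseConvergenceCLM.precomp ℂ
    (SchwartzMap.compCLMOfContinuousLinearEquiv ℂ (symplecticJ d).symm) (𝓕 u)

/-- The Born-Jordan kernel `Θ^n (x, ω) = sinc^n (x·ω)`, where `sinc t = sin (π t) / (π t)`
(and `sinc 0 = 1`). -/
def bornJordanKernel {d : ℕ} (n : ℕ) (z : Phase d) : ℂ :=
  ((Real.sinc (Real.pi * inner ℝ z.fst z.snd) ^ n : ℝ) : ℂ)

theorem memLp_bornJordanKernel (d n : ℕ) :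
    MemLp (bornJordanKernel n : Phase d → ℂ) ⊤ volume := by
  refine memLp_top_of_bound (Continuous.aestronglyMeasurable ?_) 1
    (Filter.Eventually.of_forall fun z => ?_)
  · unfold bornJordanKernel
    have := Real.continuous_sinc
    fun_prop
  · simpa [bornJordanKernel] using pow_le_one₀ (abs_nonneg _) (Real.abs_sinc_le_one _)

/-- `Θ^n` as a tempered distribution. -/
def bornJordanKernelDistribution (d n : ℕ) : 𝓢'(Phase d, ℂ) :=
  ((memLp_bornJordanKernel d n).toLp : Lp ℂ ⊤ (volume : Measure (Phase d)))

/-- `Q` is the convolution `u ∗ θ` of the function `u` with the tempered distribution `θ`: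
for every Schwartz function `φ`, the integral
`⟨u ∗ θ, φ⟩ = ∫ u z ⟨θ, φ (z + ·)⟩ dz` converges absolutely and equals `⟨Q, φ⟩`. -/
def IsConvolution {d : ℕ} (u : Phase d → ℂ) (θ Q : 𝓢'(Phase d, ℂ)) : Prop :=
  ∀ φ : 𝓢(Phase d, ℂ),
    Integrable (fun z => u z * θ (SchwartzMap.compSubConstCLM ℂ (-z) φ)) volume ∧
    Q φ = ∫ z, u z * θ (SchwartzMap.compSubConstCLM ℂ (-z) φ)

/-- `Q` is the Born-Jordan distribution of order `n` of `f`, that is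
`Q = Q^n f = W f ∗ 𝓕_σ (Θ^n)`. -/
def IsBornJordanDistribution {d : ℕ} (n : ℕ) (f : Config d → ℂ) (Q : 𝓢'(Phase d, ℂ)) : Prop :=
  IsConvolution (wigner f) (symplecticFourier (bornJordanKernelDistribution d n)) Q

section Wavefront

variable {E : Type*} [NormedAddCommGroup E] [InnerProductSpace ℝ E] [FiniteDimensional ℝ E]
  [MeasurableSpace E] [BorelSpace E]

/-- `Γ` is an open conic neighbourhood of `ξ₀` in `E \ {0}`. -/
def IsOpenConicNhd (Γ : Set E) (ξ₀ : E) : Prop :=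
  IsOpen Γ ∧ (0 : E) ∉ Γ ∧ (∀ ξ ∈ Γ, ∀ t : ℝ, 0 < t → t • ξ ∈ Γ) ∧ ξ₀ ∈ Γ

/-- The tempered distribution `u` is given by the function `h`. -/
def IsGivenBy (u : 𝓢'(E, ℂ)) (h : E → ℂ) : Prop :=
  ∀ ψ : 𝓢(E, ℂ), Integrable (fun ξ => h ξ * ψ ξ) volume ∧ u ψ = ∫ ξ, h ξ * ψ ξ

/-- `u` has regularity `H^s` at `x₀` in the direction `ξ₀`: for some cut-off function
`φ ∈ C_c^∞` with `φ x₀ ≠ 0` and some open conic neighbourhood `Γ` of `ξ₀`, the `L²(Γ)` norm of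
`𝓕[φ u](ξ) ⟨ξ⟩^s` is finite, where `⟨ξ⟩ = (1 + |ξ|²)^{1/2}`. Here `h` is the function
`𝓕[φ u]`; it exists, and is unique up to null sets, because `φ u` has compact support. -/
def HasSobolevRegularityAt (s : ℝ) (u : 𝓢'(E, ℂ)) (x₀ ξ₀ : E) : Prop :=
  ∃ φ : E → ℂ, ContDiff ℝ ∞ φ ∧ HasCompactSupport φ ∧ φ x₀ ≠ 0 ∧
    ∃ Γ : Set E, IsOpenConicNhd Γ ξ₀ ∧
      ∃ h : E → ℂ, IsGivenBy (𝓕 (TemperedDistribution.smulLeftCLM ℂ φ u)) h ∧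
        MemLp (fun ξ => h ξ * (((1 + ‖ξ‖ ^ 2) ^ (s / 2) : ℝ) : ℂ)) 2 (volume.restrict Γ)

/-- The `H^s` wave-front set of a tempered distribution. -/
def sobolevWavefrontSet (s : ℝ) (u : 𝓢'(E, ℂ)) : Set (E × E) :=
  {p | p.2 ≠ 0 ∧ ¬ HasSobolevRegularityAt s u p.1 p.2}

end Wavefront

end

/-! Plancherel in `y` puts the Wigner distribution in `L²`. Since `Θ^n` is bounded and invariant
under `J`, convolving with its symplectic Fourier transform is a Fourier multiplier: `Q = 𝓕 G` with
`G = Θ^n g` and `g = 𝓕⁻ (W f)` in `L²` (`isConvolution_bornJordan`). A cut-off `φ` gives `𝓕[φ Q](ξ)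
= ∫ G η * 𝓕 φ (ξ + η) dη`. On a cone where `|ξ₁·ξ₂| > ε |ξ|²`, `one_add_norm_sq_le` bounds `1 +
|ξ|²` by a constant times `(1 + |η₁·η₂|) (1 + |ξ + η|²)`. In the `n`-th power, the first factor is
absorbed by the decay of `Θ^n` and the second by that of `𝓕 φ`. What remains is an `L²` function
correlated with an `L¹` function, so Young's inequality concludes. -/

/-! ### Fourier integrals versus the `L²` Fourier transform. -/

section FourierL2

variable {E : Type*} [NormedAddCommGroup E] [InnerProductSpace ℝ E] [FiniteDimensional ℝ E]
  [MeasurableSpace E] [BorelSpace E]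

theorem Real.continuous_fourier_of_integrable {v : E → ℂ} (h1 : Integrable v) :
    Continuous (𝓕 v) :=
  VectorFourier.fourierIntegral_continuous Real.continuous_fourierChar
    (by simpa using continuous_inner) h1

theorem Real.integral_fourier_mul_eq {f g : E → ℂ} (hf : Integrable f) (hg : Integrable g) :
    ∫ ξ, 𝓕 f ξ * g ξ = ∫ x, f x * 𝓕 g x := by
  have := VectorFourier.integral_fourierIntegral_smul_eq_flip (L := innerₗ E)
    Real.continuous_fourierChar (by simpa using continuous_inner) hf hg
  rw [flip_innerₗ] at this
  exact this

theorem Real.integral_fourierInv_mul_eq {f g : E → ℂ} (hf : Integrable f) (hg : Integrable g) :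
    ∫ ξ, 𝓕⁻ f ξ * g ξ = ∫ x, f x * 𝓕⁻ g x := by
  have h := Real.integral_fourier_mul_eq hf hg.comp_neg
  rw [← integral_neg_eq_self] at h
  simp only [neg_neg] at h
  simp_rw [Real.fourierInv_eq_fourier_neg, h, ← Real.fourierInv_eq_fourier_comp_neg,
    ← Real.fourierInv_eq_fourier_neg]

/-- The `L²` Fourier transform of an integrable function is its Fourier integral. -/
theorem MeasureTheory.MemLp.coeFn_fourier_toLp {v : E → ℂ} (h1 : Integrable v) (h2 : MemLp v 2) :
    (𝓕 (h2.toLp v) : Lp ℂ 2 (volume : Measure E)) =ᵐ[volume] 𝓕 v := by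
  apply ae_eq_of_integral_contDiff_smul_eq
  · exact (Lp.memLp _).locallyIntegrable (by norm_num)
  · exact (Real.continuous_fourier_of_integrable h1).locallyIntegrable
  intro g g_smooth g_cpt
  have hg₁ : HasCompactSupport (Complex.ofRealCLM ∘ g) := g_cpt.comp_left rfl
  have hg₂ : ContDiff ℝ ∞ (Complex.ofRealCLM ∘ g) := by fun_prop
  set ψ : 𝓢(E, ℂ) := hg₁.toSchwartzMap hg₂
  have hψ : ∀ x, ψ x = g x := fun x => rfl
  have := congrArg (fun T : 𝓢'(E, ℂ) => T ψ) (Lp.fourier_toTemperedDistribution_eq (h2.toLp v))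
  simp only [TemperedDistribution.fourier_apply, Lp.toTemperedDistribution_apply, smul_eq_mul,
    hψ] at this
  simp only [Complex.real_smul, ← this]
  have e := Real.integral_fourier_mul_eq ψ.integrable h1
  simp only [hψ] at e
  rw [← e, ← SchwartzMap.fourier_coe]
  refine integral_congr_ae ?_
  filter_upwards [h2.coeFn_toLp] with x hx
  rw [hx]

/-- The inverse `L²` Fourier transform of an integrable function is its inverse Fourier
integral. -/
theorem MeasureTheory.MemLp.coeFn_fourierInv_toLp {v : E → ℂ} (h1 : Integrable v)
    (h2 : MemLp v 2) :
    (𝓕⁻ (h2.toLp v) : Lp ℂ 2 (volume : Measure E)) =ᵐ[volume] 𝓕⁻ v := by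
  apply ae_eq_of_integral_contDiff_smul_eq
  · exact (Lp.memLp _).locallyIntegrable (by norm_num)
  · rw [Real.fourierInv_eq_fourier_comp_neg]
    exact (Real.continuous_fourier_of_integrable h1.comp_neg).locallyIntegrable
  intro g g_smooth g_cpt
  have hg₁ : HasCompactSupport (Complex.ofRealCLM ∘ g) := g_cpt.comp_left rfl
  have hg₂ : ContDiff ℝ ∞ (Complex.ofRealCLM ∘ g) := by fun_prop
  set ψ : 𝓢(E, ℂ) := hg₁.toSchwartzMap hg₂
  have hψ : ∀ x, ψ x = g x := fun x => rfl
  have := congrArg (fun T : 𝓢'(E, ℂ) => T ψ) (Lp.fourierInv_toTemperedDistribution_eq (h2.toLp v))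
  simp only [TemperedDistribution.fourierInv_apply, Lp.toTemperedDistribution_apply, smul_eq_mul,
    hψ] at this
  simp only [Complex.real_smul, ← this]
  have e := Real.integral_fourierInv_mul_eq ψ.integrable h1
  simp only [hψ] at e
  rw [← e, ← SchwartzMap.fourierInv_coe]
  refine integral_congr_ae ?_
  filter_upwards [h2.coeFn_toLp] with x hx
  rw [hx]

theorem MeasureTheory.MemLp.fourierInv {v : E → ℂ} (h1 : Integrable v) (h2 : MemLp v 2) :
    MemLp (𝓕⁻ v) 2 :=
  (Lp.memLp _).ae_eq (h2.coeFn_fourierInv_toLp h1)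

/-- Plancherel's theorem for integrable and square integrable functions. -/
theorem MeasureTheory.MemLp.eLpNorm_fourier {v : E → ℂ} (h1 : Integrable v) (h2 : MemLp v 2) :
    eLpNorm (𝓕 v) 2 = eLpNorm v 2 := by
  rw [← eLpNorm_congr_ae (h2.coeFn_fourier_toLp h1), ← eLpNorm_congr_ae h2.coeFn_toLp,
    ← Lp.enorm_def, ← Lp.enorm_def]
  simp [← ofReal_norm]

theorem MeasureTheory.Lp.integral_mul_eq_inner (u v : Lp ℂ 2 (volume : Measure E)) :
    ∫ x, u x * v x = inner ℂ (star v) u := by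
  rw [L2.inner_def]
  refine integral_congr_ae ?_
  filter_upwards [Lp.coeFn_star v] with x hx
  simp [hx]

theorem MeasureTheory.Lp.continuous_integral_mul (v : Lp ℂ 2 (volume : Measure E)) :
    Continuous fun u : Lp ℂ 2 (volume : Measure E) => ∫ x, u x * v x := by
  simp_rw [MeasureTheory.Lp.integral_mul_eq_inner]
  exact continuous_const.inner continuous_id

/-- The inverse Fourier transform of `L²` is symmetric for the bilinear pairing. -/
theorem MeasureTheory.Lp.integral_fourierInv_mul (u v : Lp ℂ 2 (volume : Measure E)) :
    ∫ x, (𝓕⁻ u : Lp ℂ 2 (volume : Measure E)) x * v x =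
      ∫ x, u x * (𝓕⁻ v : Lp ℂ 2 (volume : Measure E)) x := by
  -- Both sides are continuous in `u`, so Schwartz `u` suffice; there the identity is the definition
  -- of `𝓕⁻` on distributions.
  refine DenseRange.induction_on (p := fun u : Lp ℂ 2 (volume : Measure E) =>
    ∫ x, (𝓕⁻ u : Lp ℂ 2 (volume : Measure E)) x * v x =
      ∫ x, u x * (𝓕⁻ v : Lp ℂ 2 (volume : Measure E)) x)
    (SchwartzMap.denseRange_toLpCLM (p := 2) ENNReal.ofNat_ne_top) u ?_ ?_
  · exact isClosed_eq ((Lp.continuous_integral_mul v).comp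
      (Lp.fourierTransformₗᵢ E ℂ).symm.continuous) (Lp.continuous_integral_mul _)
  · intro ψ
    have := congrArg (fun T : 𝓢'(E, ℂ) => T ψ) (Lp.fourierInv_toTemperedDistribution_eq v)
    simp only [TemperedDistribution.fourierInv_apply, Lp.toTemperedDistribution_apply,
      smul_eq_mul] at this
    simp only [SchwartzMap.toLpCLM_apply, SchwartzMap.toLp_fourierInv_eq]
    refine Eq.trans ?_ (this.trans ?_) <;> refine integral_congr_ae ?_
    · filter_upwards [(𝓕⁻ ψ).coeFn_toLp 2 volume] with x hx
      rw [hx]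
    · filter_upwards [ψ.coeFn_toLp 2 volume] with x hx
      rw [hx]

end FourierL2

/-! ### Young's inequality `L² * L¹ ⊂ L²`. -/

section Young

variable {E : Type*} [NormedAddCommGroup E] [MeasurableSpace E] [BorelSpace E]
  [SecondCountableTopology E]

theorem MeasureTheory.Integrable.mul_comp_add {μ : Measure E} [SFinite μ] [μ.IsAddLeftInvariant]
    {a b : E → ℂ} (ha : Integrable a μ) (hb : Integrable b μ) :
    Integrable (fun p : E × E => a p.1 * b (p.1 + p.2)) (μ.prod μ) :=
  (measurePreserving_prod_add μ μ).integrable_comp_of_integrable (ha.mul_prod hb)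

/-- Cauchy-Schwarz after splitting `M K = (M² K)^{1/2} K^{1/2}`. -/
theorem lintegral_mul_sq_le {α : Type*} [MeasurableSpace α] {μ : Measure α} {M K : α → ENNReal}
    (hM : AEMeasurable M μ) (hK : AEMeasurable K μ) :
    (∫⁻ x, M x * K x ∂μ) ^ 2 ≤ (∫⁻ x, M x ^ 2 * K x ∂μ) * ∫⁻ x, K x ∂μ := by
  have h := ENNReal.lintegral_mul_norm_pow_le ((hM.pow_const 2).mul hK) hK
    (p := 1 / 2) (q := 1 / 2) (by norm_num) (by norm_num) (by norm_num)
  have e : ∀ x, ((fun x => M x ^ 2) * K) x ^ (1 / 2 : ℝ) * K x ^ (1 / 2 : ℝ) = M x * K x := by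
    intro x
    rw [Pi.mul_apply, ENNReal.mul_rpow_of_nonneg _ _ (by norm_num), mul_assoc,
      ← ENNReal.rpow_add_of_nonneg _ _ (by norm_num) (by norm_num), ← ENNReal.rpow_natCast_mul]
    norm_num
  simp only [e] at h
  calc _ ≤ _ := pow_le_pow_left' h 2
    _ = _ := by
      rw [mul_pow, ← ENNReal.rpow_mul_natCast, ← ENNReal.rpow_mul_natCast]
      norm_num

/-- Young's inequality for the correlation of an `L²` function and an `L¹` function. -/
theorem lintegral_correlation_sq_le {μ : Measure E} [SFinite μ] [μ.IsAddLeftInvariant]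
    {M K : E → ENNReal} (hM : AEMeasurable M μ) (hK : Measurable K) :
    ∫⁻ ξ, (∫⁻ η, M η * K (ξ + η) ∂μ) ^ 2 ∂μ ≤ (∫⁻ x, M x ^ 2 ∂μ) * (∫⁻ x, K x ∂μ) ^ 2 := by
  calc _ ≤ ∫⁻ ξ, (∫⁻ η, M η ^ 2 * K (ξ + η) ∂μ) * ∫⁻ x, K x ∂μ ∂μ := by
        gcongr with ξ
        refine (lintegral_mul_sq_le hM (by fun_prop)).trans_eq ?_
        rw [lintegral_add_left_eq_self]
    _ = (∫⁻ η, ∫⁻ ξ, M η ^ 2 * K (ξ + η) ∂μ ∂μ) * ∫⁻ x, K x ∂μ := by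
        have h : AEMeasurable (fun p : E × E => M p.2 ^ 2 * K (p.1 + p.2)) (μ.prod μ) :=
          (hM.comp_snd.pow_const 2).mul (hK.comp measurable_add).aemeasurable
        rw [lintegral_mul_const'' _ h.lintegral_prod_right', lintegral_lintegral_swap h]
    _ = _ := by
        have : ∀ η, ∫⁻ ξ, M η ^ 2 * K (ξ + η) ∂μ = M η ^ 2 * ∫⁻ x, K x ∂μ := fun η => by
          rw [lintegral_const_mul _ (by fun_prop)]
          simp_rw [add_comm _ η]
          rw [lintegral_add_left_eq_self]
        simp_rw [this]
        rw [lintegral_mul_const'' _ (hM.pow_const 2), sq, mul_assoc]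

end Young

/-! ### Square integrability of the Wigner distribution. -/

section Wigner

/-- The map is the shear `(x, y) ↦ (x + y/2, y)` followed by `(a, y) ↦ (a, a - y)`. -/
theorem measurePreserving_wigner_coordinates {d : ℕ} :
    MeasurePreserving (fun p : Config d × Config d =>
      (p.1 + (1 / 2 : ℝ) • p.2, p.1 - (1 / 2 : ℝ) • p.2)) := by
  have h1 : MeasurePreserving (fun p : Config d × Config d => (p.1 + (1 / 2 : ℝ) • p.2, p.2)) := by
    have := (MeasurePreserving.id (volume : Measure (Config d))).skew_product
      (μc := (volume : Measure (Config d))) (μd := (volume : Measure (Config d)))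
      (g := fun y x => x + (1 / 2 : ℝ) • y) (by fun_prop)
      (Filter.Eventually.of_forall fun y => (measurePreserving_add_right _ _).map_eq)
    exact (Measure.measurePreserving_swap.comp this).comp Measure.measurePreserving_swap
  have h2 : MeasurePreserving (fun p : Config d × Config d => (p.1, p.1 - p.2)) :=
    (MeasurePreserving.id (volume : Measure (Config d))).skew_product
      (μc := (volume : Measure (Config d))) (μd := (volume : Measure (Config d)))
      (g := fun a y => a - y) (by fun_prop)
      (Filter.Eventually.of_forall fun a => (Measure.measurePreserving_sub_left _ a).map_eq)
  convert h2.comp h1 using 2 with p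
  simp only [Function.comp_apply, Prod.mk.injEq, true_and]
  module

theorem memLp_wigner_kernel {d : ℕ} {f : Config d → ℂ} (hf : MemLp f 2) :
    MemLp (fun p : Config d × Config d => f (p.1 + (1 / 2 : ℝ) • p.2) *
      (starRingEnd ℂ) (f (p.1 - (1 / 2 : ℝ) • p.2))) 2 := by
  have h : MemLp (fun p : Config d × Config d => f p.1 * (starRingEnd ℂ) (f p.2)) 2 := by
    have hm : AEStronglyMeasurable (fun p : Config d × Config d => f p.1 * (starRingEnd ℂ) (f p.2))
        volume :=
      hf.1.comp_fst.mul (RCLike.continuous_conj.comp_aestronglyMeasurable hf.1.comp_snd)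
    rw [memLp_two_iff_integrable_sq_norm hm]
    have := (memLp_two_iff_integrable_sq_norm hf.1).1 hf
    simpa only [norm_mul, mul_pow, RCLike.norm_conj] using! this.mul_prod this
  exact h.comp_measurePreserving measurePreserving_wigner_coordinates

theorem wigner_eq_fourier {d : ℕ} (f : Config d → ℂ) (z : Phase d) :
    wigner f z = 𝓕 (fun y => f (z.fst + (1 / 2 : ℝ) • y) *
      (starRingEnd ℂ) (f (z.fst - (1 / 2 : ℝ) • y))) z.snd := by
  rw [Real.fourier_eq', wigner]
  refine integral_congr_ae (Filter.Eventually.of_forall fun y => ?_)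
  simp only [smul_eq_mul, mul_assoc]
  congr 2
  push_cast
  ring

theorem integrable_wigner_kernel {d : ℕ} {f : Config d → ℂ} (hf : MemLp f 2) {x : Config d}
    (hm : AEStronglyMeasurable fun y =>
      f (x + (1 / 2 : ℝ) • y) * (starRingEnd ℂ) (f (x - (1 / 2 : ℝ) • y))) :
    Integrable fun y => f (x + (1 / 2 : ℝ) • y) * (starRingEnd ℂ) (f (x - (1 / 2 : ℝ) • y)) := by
  have h := (memLp_two_iff_integrable_sq_norm hf.1).1 hf
  have h1 : Integrable fun y => ‖f (x + (1 / 2 : ℝ) • y)‖ ^ 2 :=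
    (h.comp_add_left x).comp_smul (by norm_num)
  have h2 : Integrable fun y => ‖f (x - (1 / 2 : ℝ) • y)‖ ^ 2 :=
    (h.comp_sub_left x).comp_smul (by norm_num)
  refine (h1.add h2).mono' hm (Filter.Eventually.of_forall fun y => ?_)
  simp only [norm_mul, RCLike.norm_conj, Pi.add_apply]
  nlinarith [sq_nonneg (‖f (x + (1 / 2 : ℝ) • y)‖ - ‖f (x - (1 / 2 : ℝ) • y)‖),
    sq_nonneg ‖f (x + (1 / 2 : ℝ) • y)‖, sq_nonneg ‖f (x - (1 / 2 : ℝ) • y)‖]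

theorem memLp_wigner {d : ℕ} {f : Config d → ℂ} (hf : MemLp f 2) : MemLp (wigner f) 2 := by
  set k : Config d × Config d → ℂ := fun p => f (p.1 + (1 / 2 : ℝ) • p.2) *
      (starRingEnd ℂ) (f (p.1 - (1 / 2 : ℝ) • p.2)) with hk
  have hkL : MemLp k 2 := memLp_wigner_kernel hf
  suffices h : MemLp (fun p : Config d × Config d => 𝓕 (fun y => k (p.1, y)) p.2) 2 by
    rw [show wigner f = (fun p : Config d × Config d => 𝓕 (fun y => k (p.1, y)) p.2) ∘ WithLp.ofLp
      from funext (wigner_eq_fourier f)]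
    exact h.comp_measurePreserving (WithLp.volume_preserving_ofLp (Config d) (Config d))
  have hm : AEStronglyMeasurable (fun p : Config d × Config d => 𝓕 (fun y => k (p.1, y)) p.2)
      volume := by
    simp_rw [Real.fourier_eq']
    have hkm : AEStronglyMeasurable (fun q : (Config d × Config d) × Config d => k (q.1.1, q.2))
        (volume.prod volume) :=
      hkL.1.comp_quasiMeasurePreserving
        (QuasiMeasurePreserving.prodMap Measure.quasiMeasurePreserving_fst (.id volume))
    have hc : Continuous fun q : (Config d × Config d) × Config d =>
        Complex.exp (↑(-2 * Real.pi * inner ℝ q.2 q.1.2) * Complex.I) := by fun_prop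
    exact AEStronglyMeasurable.integral_prod_right' (f := fun q : (Config d × Config d) × Config d =>
      Complex.exp (↑(-2 * Real.pi * inner ℝ q.2 q.1.2) * Complex.I) • k (q.1.1, q.2))
      (hc.aestronglyMeasurable.smul hkm)
  refine ⟨hm, ?_⟩
  rw [eLpNorm_lt_top_iff_lintegral_rpow_enorm_lt_top (by norm_num) (by norm_num)]
  have hk2 := (eLpNorm_lt_top_iff_lintegral_rpow_enorm_lt_top (by norm_num) (by norm_num)).1 hkL.2
  refine lt_of_le_of_lt ?_ hk2
  rw [Measure.volume_eq_prod, lintegral_prod _ (by fun_prop), lintegral_prod _ (by have := hkL.1; fun_prop)]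
  refine lintegral_mono_ae ?_
  -- Almost every slice `k (x, ·)` lies in `L¹ ∩ L²`, so Plancherel applies to its Fourier integral;
  -- Tonelli then sums over `x`.
  filter_upwards [hkL.1.prodMk_left, ((memLp_two_iff_integrable_sq_norm hkL.1).1 hkL).prod_right_ae]
    with x hx1 hx2
  have := MemLp.eLpNorm_fourier (integrable_wigner_kernel hf hx1)
    ((memLp_two_iff_integrable_sq_norm hx1).2 hx2)
  rw [eLpNorm_eq_lintegral_rpow_enorm_toReal (by norm_num) (by norm_num),
    eLpNorm_eq_lintegral_rpow_enorm_toReal (by norm_num) (by norm_num)] at this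
  have := (ENNReal.rpow_left_injective (by norm_num)) this
  exact this.le

end Wigner

/-! ### Cut-offs of `𝓕 G` and weighted estimates on a cone. -/

section Localization

variable {E : Type*} [NormedAddCommGroup E] [InnerProductSpace ℝ E] [FiniteDimensional ℝ E]
  [MeasurableSpace E] [BorelSpace E]

/-- Modulating `φ` by the character of frequency `η` translates `𝓕 φ`, and one Fourier transform
moves across the integral. Two forward transforms are involved, hence `ξ + η` rather than `ξ - η`.
-/
theorem SchwartzMap.fourier_smulLeftCLM_fourier_apply (φ ψ : 𝓢(E, ℂ)) (η : E) :
    𝓕 (smulLeftCLM ℂ φ (𝓕 ψ)) η = ∫ ξ, 𝓕 φ (ξ + η) * ψ ξ := by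
  set e : E → ℂ := fun x => Complex.exp (↑(-2 * Real.pi * inner ℝ x η) * Complex.I) * φ x with he
  have hint : Integrable e := by
    refine (φ.integrable (μ := volume)).norm.mono' ?_ (Filter.Eventually.of_forall fun x => ?_)
    · exact Continuous.aestronglyMeasurable (by have := φ.continuous; fun_prop)
    · rw [norm_mul, Complex.norm_exp_ofReal_mul_I, one_mul]
  have h1 : ∀ ξ, 𝓕 e ξ = 𝓕 φ (ξ + η) := fun ξ => by
    rw [SchwartzMap.fourier_coe, Real.fourier_eq', Real.fourier_eq']
    refine integral_congr_ae (Filter.Eventually.of_forall fun x => ?_)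
    simp only [he, smul_eq_mul, ← mul_assoc, ← Complex.exp_add, inner_add_right]
    congr 2
    push_cast
    ring
  rw [SchwartzMap.fourier_coe, Real.fourier_eq']
  simp_rw [← h1]
  rw [Real.integral_fourier_mul_eq hint ψ.integrable]
  refine integral_congr_ae (Filter.Eventually.of_forall fun x => ?_)
  simp only [he, smulLeftCLM_apply_apply φ.hasTemperateGrowth, SchwartzMap.fourier_coe, smul_eq_mul,
    mul_assoc]

/-- Justifies Fubini below: the integrand is at most `|κ| (|G|² + |ψ|²)`, a sum of two correlations
of `L¹` functions. -/
theorem integrable_correlation_prod {G : E → ℂ} (hG : MemLp G 2) (κ ψ : 𝓢(E, ℂ)) :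
    Integrable (fun p : E × E => G p.1 * κ (p.2 + p.1) * ψ p.2) (volume.prod volume) := by
  have hG2 : Integrable fun x => ((‖G x‖ ^ 2 : ℝ) : ℂ) :=
    ((memLp_two_iff_integrable_sq_norm hG.1).1 hG).ofReal
  have hψ2 : Integrable fun x => ((‖ψ x‖ ^ 2 : ℝ) : ℂ) :=
    ((memLp_two_iff_integrable_sq_norm (ψ.memLp 2).1).1 (ψ.memLp 2)).ofReal
  have h1 := (hG2.mul_comp_add κ.integrable).norm
  have h2 := (hψ2.mul_comp_add κ.integrable).norm.swap
  refine (h1.add h2).mono' ?_ (Filter.Eventually.of_forall fun p => ?_)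
  · exact (hG.1.comp_fst.mul (κ.continuous.comp (by fun_prop)).aestronglyMeasurable).mul
      (ψ.continuous.comp continuous_snd).aestronglyMeasurable
  · simp only [norm_mul, Pi.add_apply, Function.comp_apply, Prod.fst_swap, Prod.snd_swap,
      Complex.norm_real, norm_pow, norm_norm, add_comm p.1 p.2]
    nlinarith [mul_nonneg (norm_nonneg (κ (p.2 + p.1))) (sq_nonneg (‖G p.1‖ - ‖ψ p.2‖)),
      mul_nonneg (norm_nonneg (κ (p.2 + p.1))) (sq_nonneg (‖G p.1‖)),
      mul_nonneg (norm_nonneg (κ (p.2 + p.1))) (sq_nonneg (‖ψ p.2‖))]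

/-- The Fourier transform of the product of a Schwartz function `φ` with the Fourier transform of
an `L²` function. -/
theorem isGivenBy_fourier_smulLeftCLM {G : E → ℂ} (hG : MemLp G 2) (φ : 𝓢(E, ℂ)) :
    IsGivenBy (𝓕 (TemperedDistribution.smulLeftCLM ℂ φ
      (𝓕 (Lp.toTemperedDistribution (hG.toLp G))))) (fun ξ => ∫ η, G η * 𝓕 φ (ξ + η)) := by
  intro ψ
  have hI := integrable_correlation_prod hG (𝓕 φ) ψ
  have e : ∀ ξ, (∫ η, G η * 𝓕 φ (ξ + η)) * ψ ξ = ∫ η, G η * 𝓕 φ (ξ + η) * ψ ξ :=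
    fun ξ => (integral_mul_const _ _).symm
  simp_rw [e]
  refine ⟨hI.integral_prod_right, ?_⟩
  rw [integral_integral_swap (f := fun ξ η => G η * 𝓕 φ (ξ + η) * ψ ξ) hI.swap]
  rw [TemperedDistribution.fourier_apply, TemperedDistribution.smulLeftCLM_apply_apply,
    TemperedDistribution.fourier_apply, Lp.toTemperedDistribution_apply]
  refine integral_congr_ae ?_
  filter_upwards [hG.coeFn_toLp] with η hη
  rw [hη, fourier_smulLeftCLM_fourier_apply, smul_eq_mul, mul_comm, ← integral_const_mul]
  simp only [mul_assoc]

theorem memLp_correlation_weight {G M κ K w : E → ℂ} {Γ : Set E} (hΓ : MeasurableSet Γ)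
    (hG : AEStronglyMeasurable G volume) (hM : MemLp M 2) (hκ : Continuous κ) (hw : Continuous w)
    (hK : Continuous K) (hKi : Integrable K)
    (hle : ∀ ξ ∈ Γ, ∀ η, ‖G η * κ (ξ + η) * w ξ‖ ≤ ‖M η * K (ξ + η)‖) :
    MemLp (fun ξ => (∫ η, G η * κ (ξ + η)) * w ξ) 2 (volume.restrict Γ) := by
  have hm : AEStronglyMeasurable (fun ξ => (∫ η, G η * κ (ξ + η)) * w ξ) volume := by
    refine AEStronglyMeasurable.mul ?_ hw.aestronglyMeasurable
    exact AEStronglyMeasurable.integral_prod_right' (f := fun p : E × E => G p.2 * κ (p.1 + p.2))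
      (hG.comp_snd.mul (hκ.comp continuous_add).aestronglyMeasurable)
  refine ⟨hm.restrict, ?_⟩
  rw [eLpNorm_lt_top_iff_lintegral_rpow_enorm_lt_top (by norm_num) (by norm_num)]
  have hM2 := (eLpNorm_lt_top_iff_lintegral_rpow_enorm_lt_top (by norm_num) (by norm_num)).1 hM.2
  simp only [ENNReal.toReal_ofNat, ENNReal.rpow_ofNat] at hM2 ⊢
  calc _ ≤ ∫⁻ ξ in Γ, (∫⁻ η, ‖M η‖ₑ * ‖K (ξ + η)‖ₑ) ^ 2 := by
        refine setLIntegral_mono' hΓ fun ξ hξ => pow_le_pow_left' ?_ 2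
        rw [← integral_mul_const]
        refine (enorm_integral_le_lintegral_enorm _).trans (lintegral_mono fun η => ?_)
        rw [← enorm_mul]
        exact enorm_le_iff_norm_le.2 (hle ξ hξ η)
    _ ≤ ∫⁻ ξ, (∫⁻ η, ‖M η‖ₑ * ‖K (ξ + η)‖ₑ) ^ 2 := setLIntegral_le_lintegral _ _
    _ ≤ _ := lintegral_correlation_sq_le hM.1.enorm hK.enorm.measurable
    _ < _ := ENNReal.mul_lt_top hM2 (ENNReal.pow_lt_top hKi.2)

end Localization

/-! ### The Born-Jordan multiplier and microlocal regularity. -/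

section BornJordan

variable {d : ℕ}

/-- The map `J` of the phase space as a linear isometry. -/
noncomputable def symplecticJIsometry (d : ℕ) : Phase d ≃ₗᵢ[ℝ] Phase d where
  toLinearEquiv := (symplecticJ d).toLinearEquiv
  norm_map' z := by
    change ‖symplecticJ d z‖ = ‖z‖
    rw [← sq_eq_sq₀ (norm_nonneg _) (norm_nonneg _), WithLp.prod_norm_sq_eq_of_L2,
      WithLp.prod_norm_sq_eq_of_L2, symplecticJ_apply]
    simp [add_comm]

theorem bornJordanKernel_symplecticJIsometry (n : ℕ) (z : Phase d) :
    bornJordanKernel n (symplecticJIsometry d z) = bornJordanKernel n z := by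
  have : symplecticJIsometry d z = WithLp.toLp 2 (z.snd, -z.fst) := rfl
  simp [bornJordanKernel, this, real_inner_comm]

theorem continuous_bornJordanKernel (n : ℕ) : Continuous (bornJordanKernel n : Phase d → ℂ) := by
  unfold bornJordanKernel
  have := Real.continuous_sinc
  fun_prop

/-- Both `|sinc (π t)|` and `|t sinc (π t)| = |sin (π t)| / π` are at most `1`. -/
theorem norm_bornJordanKernel_mul_le (n : ℕ) (z : Phase d) :
    ‖bornJordanKernel n z‖ * (1 + |inner ℝ z.fst z.snd|) ^ n ≤ 2 ^ n := by
  rw [bornJordanKernel, Complex.norm_real, norm_pow, ← mul_pow, Real.norm_eq_abs]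
  set t := inner ℝ z.fst z.snd
  refine pow_le_pow_left₀ (by positivity) ?_ n
  have h1 := Real.abs_sinc_le_one (Real.pi * t)
  have h2 : |Real.sinc (Real.pi * t)| * |t| ≤ 1 := by
    rcases eq_or_ne t 0 with h | h
    · simp [h]
    · rw [Real.sinc_of_ne_zero (by positivity), ← abs_mul,
        show Real.sin (Real.pi * t) / (Real.pi * t) * t = Real.sin (Real.pi * t) / Real.pi by
          field_simp, abs_div, abs_of_pos Real.pi_pos, div_le_one Real.pi_pos]
      linarith [Real.abs_sin_le_one (Real.pi * t), Real.pi_gt_three]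
  linarith

theorem norm_bornJordanKernel_le_one (n : ℕ) (z : Phase d) : ‖bornJordanKernel n z‖ ≤ 1 := by
  simpa [bornJordanKernel] using pow_le_one₀ (abs_nonneg _) (Real.abs_sinc_le_one _)

theorem MeasureTheory.MemLp.bornJordanKernel_mul (n : ℕ) {g : Phase d → ℂ} (hg : MemLp g 2) :
    MemLp (fun η => bornJordanKernel n η * g η) 2 :=
  hg.of_le ((continuous_bornJordanKernel n).aestronglyMeasurable.mul hg.1)
    (Filter.Eventually.of_forall fun η => by
      simpa using mul_le_of_le_one_left (norm_nonneg _) (norm_bornJordanKernel_le_one n η))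

theorem integrable_bornJordanKernel_mul (n : ℕ) {g : Phase d → ℂ} (hg : Integrable g) :
    Integrable (fun η => bornJordanKernel n η * g η) :=
  hg.mono ((continuous_bornJordanKernel n).aestronglyMeasurable.mul hg.1)
    (Filter.Eventually.of_forall fun η => by
      simpa using mul_le_of_le_one_left (norm_nonneg _) (norm_bornJordanKernel_le_one n η))

theorem symplecticFourier_apply (u : 𝓢'(Phase d, ℂ)) (ψ : 𝓢(Phase d, ℂ)) :
    symplecticFourier u ψ =
      u (𝓕 (compCLMOfContinuousLinearEquiv ℂ (symplecticJ d).symm ψ)) := rfl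

theorem bornJordanKernelDistribution_apply (n : ℕ) (ψ : 𝓢(Phase d, ℂ)) :
    bornJordanKernelDistribution d n ψ = ∫ w, ψ w * bornJordanKernel n w := by
  rw [bornJordanKernelDistribution, Lp.toTemperedDistribution_apply]
  refine integral_congr_ae ?_
  filter_upwards [(memLp_bornJordanKernel d n).coeFn_toLp] with w hw
  rw [hw, smul_eq_mul]

theorem fourier_comp_symplecticJ_symm_translate (φ : 𝓢(Phase d, ℂ)) (z w : Phase d) :
    𝓕 (compCLMOfContinuousLinearEquiv ℂ (symplecticJ d).symm (compSubConstCLM ℂ (-z) φ)) w =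
      Complex.exp (↑(2 * Real.pi * inner ℝ ((symplecticJIsometry d).symm w) z) * Complex.I) *
        𝓕 φ ((symplecticJIsometry d).symm w) := by
  have e : ⇑(compCLMOfContinuousLinearEquiv ℂ (symplecticJ d).symm (compSubConstCLM ℂ (-z) φ)) =
      ((φ : Phase d → ℂ) ∘ fun x => x + z) ∘ (symplecticJIsometry d).symm := by
    ext x
    simp only [compCLMOfContinuousLinearEquiv_apply, Function.comp_apply, compSubConstCLM_apply,
      sub_neg_eq_add]
    rfl
  rw [SchwartzMap.fourier_coe, e, Real.fourier_comp_linearIsometry]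
  have := congrFun (VectorFourier.fourierIntegral_comp_add_right Real.fourierChar volume
    (innerₗ (Phase d)) φ z) ((symplecticJIsometry d).symm w)
  refine this.trans ?_
  rw [Circle.smul_def, Real.fourierChar_apply, innerₗ_apply_apply, real_inner_comm]
  rfl

/-- Translation becomes modulation under `𝓕`; changing variables by the isometry `J`, which fixes
`Θ^n`, then removes `J`. -/
theorem symplecticFourier_bornJordanKernel_translate (n : ℕ) (φ : 𝓢(Phase d, ℂ)) (z : Phase d) :
    symplecticFourier (bornJordanKernelDistribution d n) (compSubConstCLM ℂ (-z) φ) =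
      𝓕⁻ (fun η => bornJordanKernel n η * 𝓕 φ η) z := by
  rw [symplecticFourier_apply, bornJordanKernelDistribution_apply, Real.fourierInv_eq',
    ← (symplecticJIsometry d).measurePreserving.integral_comp
    (symplecticJIsometry d).toHomeomorph.measurableEmbedding]
  refine integral_congr_ae (Filter.Eventually.of_forall fun x => ?_)
  simp only [fourier_comp_symplecticJ_symm_translate, LinearIsometryEquiv.symm_apply_apply,
    bornJordanKernel_symplecticJIsometry, smul_eq_mul]
  ring

/-- The convolution of an `L²` function `u` with `𝓕_σ (Θ^n)` is the Fourier transform of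
`Θ^n 𝓕⁻ u`. -/
theorem isConvolution_bornJordan (n : ℕ) {u : Phase d → ℂ} (hu : MemLp u 2) :
    IsConvolution u (symplecticFourier (bornJordanKernelDistribution d n))
      (𝓕 (Lp.toTemperedDistribution (((Lp.memLp (𝓕⁻ (hu.toLp u) :
        Lp ℂ 2 (volume : Measure (Phase d)))).bornJordanKernel_mul n).toLp _))) := by
  intro φ
  set v : Phase d → ℂ := fun η => bornJordanKernel n η * 𝓕 φ η with hv
  have hv1 : Integrable v := integrable_bornJordanKernel_mul n (𝓕 φ).integrable
  have hv2 : MemLp v 2 := ((𝓕 φ).memLp 2).bornJordanKernel_mul n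
  simp_rw [symplecticFourier_bornJordanKernel_translate]
  refine ⟨hu.integrable_mul (hv2.fourierInv hv1), ?_⟩
  have h := Lp.integral_fourierInv_mul (hu.toLp u) (hv2.toLp v)
  rw [TemperedDistribution.fourier_apply, Lp.toTemperedDistribution_apply]
  refine Eq.trans ?_ (h.trans ?_) <;> refine integral_congr_ae ?_
  · filter_upwards [hv2.coeFn_toLp, ((Lp.memLp (𝓕⁻ (hu.toLp u) :
        Lp ℂ 2 (volume : Measure (Phase d)))).bornJordanKernel_mul n).coeFn_toLp] with x h1 h2
    rw [h1, h2, hv, smul_eq_mul]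
    ring
  · filter_upwards [hu.coeFn_toLp, hv2.coeFn_fourierInv_toLp hv1] with x h1 h2
    rw [h1, h2]

theorem isOpenConicNhd_inner_fst_snd {ζ : Phase d} {ε : ℝ}
    (hζ : ε * ‖ζ‖ ^ 2 < |inner ℝ ζ.fst ζ.snd|) :
    IsOpenConicNhd {ξ : Phase d | ε * ‖ξ‖ ^ 2 < |inner ℝ ξ.fst ξ.snd|} ζ := by
  refine ⟨isOpen_lt (by fun_prop) (by fun_prop), by simp, fun ξ hξ t ht => ?_, hζ⟩
  simp only [Set.mem_ofPred_eq] at hξ ⊢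
  rw [norm_smul, WithLp.smul_fst, WithLp.smul_snd, real_inner_smul_left, real_inner_smul_right,
    abs_mul, abs_mul, abs_of_pos ht, Real.norm_eq_abs, abs_of_pos ht]
  have := mul_lt_mul_of_pos_left hξ (pow_pos ht 2)
  linarith

/-- With `δ = ξ + η`, the quantities `ξ₁·ξ₂` and `η₁·η₂` differ by at most `|δ|² + 2 |δ| |ξ|`. The
cross term is absorbed into half of `ε |ξ|²` at the cost of `(2/ε) |δ|²`. -/
theorem one_add_norm_sq_le {ε : ℝ} (hε : 0 < ε) {ξ : Phase d}
    (hξ : ε * ‖ξ‖ ^ 2 < |inner ℝ ξ.fst ξ.snd|) (η : Phase d) :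
    1 + ‖ξ‖ ^ 2 ≤ (1 + 2 / ε * (1 + 2 / ε)) * (1 + |inner ℝ η.fst η.snd|) * (1 + ‖ξ + η‖ ^ 2) := by
  obtain ⟨δ, rfl⟩ : ∃ δ, η = δ - ξ := ⟨ξ + η, by abel⟩
  have hf : ∀ x : Phase d, ‖x.fst‖ ≤ ‖x‖ := fun x => WithLp.norm_fst_le _ x
  have hs : ∀ x : Phase d, ‖x.snd‖ ≤ ‖x‖ := fun x => WithLp.norm_snd_le _ x
  have hcs : ∀ x y : Phase d, |inner ℝ x.fst y.snd| ≤ ‖x‖ * ‖y‖ := fun x y =>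
    (abs_real_inner_le_norm _ _).trans (mul_le_mul (hf x) (hs y) (norm_nonneg _) (norm_nonneg _))
  have h1 := hcs δ δ
  have h2 := hcs δ ξ
  have h3 := hcs ξ δ
  rw [add_sub_cancel]
  have e : inner ℝ ξ.fst ξ.snd = inner ℝ (δ - ξ).fst (δ - ξ).snd - inner ℝ δ.fst δ.snd +
      inner ℝ δ.fst ξ.snd + inner ℝ ξ.fst δ.snd := by
    simp only [WithLp.sub_fst, WithLp.sub_snd, inner_sub_left, inner_sub_right]
    ring
  set t := |inner ℝ (δ - ξ).fst (δ - ξ).snd|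
  have ht : 0 ≤ t := abs_nonneg _
  have h4 : |inner ℝ ξ.fst ξ.snd| ≤ t + ‖δ‖ * ‖δ‖ + ‖δ‖ * ‖ξ‖ + ‖ξ‖ * ‖δ‖ := by
    rw [e]
    refine (abs_add_le _ _).trans (add_le_add ((abs_add_le _ _).trans (add_le_add
      ((abs_sub _ _).trans (add_le_add le_rfl h1)) h2)) h3)
  set c := 2 / ε with hc
  have hcε : c * ε = 2 := by rw [hc]; field_simp
  have hc0 : 0 < c := by positivity
  have h5 : 2 * ‖ξ‖ * ‖δ‖ ≤ ε / 2 * ‖ξ‖ ^ 2 + c * ‖δ‖ ^ 2 := by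
    have := mul_nonneg (half_pos hε).le (sq_nonneg (‖ξ‖ - c * ‖δ‖))
    have e2 : ε / 2 * (‖ξ‖ - c * ‖δ‖) ^ 2 = ε / 2 * ‖ξ‖ ^ 2 - (c * ε) * (‖ξ‖ * ‖δ‖) +
      (c * ε) / 2 * (c * ‖δ‖ ^ 2) := by ring
    rw [e2, hcε] at this
    linarith
  have h6 : ε / 2 * ‖ξ‖ ^ 2 ≤ t + (1 + c) * ‖δ‖ ^ 2 := by linarith
  have h7 : ‖ξ‖ ^ 2 ≤ c * t + c * (1 + c) * ‖δ‖ ^ 2 := by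
    have := mul_le_mul_of_nonneg_left h6 hc0.le
    have e3 : c * (ε / 2 * ‖ξ‖ ^ 2) = c * ε / 2 * ‖ξ‖ ^ 2 := by ring
    rw [e3, hcε] at this
    linarith
  have hD : 0 ≤ ‖δ‖ ^ 2 := sq_nonneg _
  have := mul_nonneg ht hD
  have hcc : 0 ≤ c * c := by positivity
  nlinarith [mul_nonneg hcc ht, mul_nonneg hc0.le this, mul_nonneg hcc this]

theorem hasSobolevRegularityAt_bornJordan (n : ℕ) {g : Phase d → ℂ} (hg : MemLp g 2)
    (z : Phase d) {ζ : Phase d} (hζ : inner ℝ ζ.fst ζ.snd ≠ 0) :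
    HasSobolevRegularityAt (2 * n : ℝ)
      (𝓕 (Lp.toTemperedDistribution ((hg.bornJordanKernel_mul n).toLp _))) z ζ := by
  let b : ContDiffBump z := default
  have hb : ContDiff ℝ ∞ fun x => (b x : ℂ) := Complex.ofRealCLM.contDiff.comp b.contDiff
  have hbc : HasCompactSupport fun x => (b x : ℂ) :=
    b.hasCompactSupport.comp_left (g := Complex.ofReal) rfl
  have hζ0 : ζ ≠ 0 := by rintro rfl; simp at hζ
  have hN : 0 < ‖ζ‖ ^ 2 := by positivity
  -- Half of the ratio at `ζ`, so that `ζ` satisfies the strict inequality defining the cone.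
  set ε := |inner ℝ ζ.fst ζ.snd| / (2 * ‖ζ‖ ^ 2) with hε
  have hε0 : 0 < ε := by positivity
  have hΓ := isOpenConicNhd_inner_fst_snd (ζ := ζ) (ε := ε) (by
    have : ε * ‖ζ‖ ^ 2 = |inner ℝ ζ.fst ζ.snd| / 2 := by rw [hε]; field_simp
    rw [this]
    exact half_lt_self (by positivity))
  set φ : 𝓢(Phase d, ℂ) := hbc.toSchwartzMap hb
  set C := 1 + 2 / ε * (1 + 2 / ε)
  have hC : 0 < C := by positivity
  have htg : (fun x : Phase d => (((1 + ‖x‖ ^ 2) ^ n : ℝ) : ℂ)).HasTemperateGrowth := by fun_prop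
  set K : 𝓢(Phase d, ℂ) := smulLeftCLM ℂ (fun x : Phase d => (((1 + ‖x‖ ^ 2) ^ n : ℝ) : ℂ)) (𝓕 φ)
  have hK : ∀ x, K x = (((1 + ‖x‖ ^ 2) ^ n : ℝ) : ℂ) * 𝓕 φ x := fun x =>
    smulLeftCLM_apply_apply htg _ _
  -- `M` carries the part of the weight depending on `η`, `K` the part depending on `ξ + η`; the
  -- decay of `Θ^n` keeps `M` in `L²`.
  set M : Phase d → ℂ := fun η => ((C ^ n * (1 + |inner ℝ η.fst η.snd|) ^ n : ℝ) : ℂ) *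
    (bornJordanKernel n η * g η) with hMdef
  have hM : MemLp M 2 := by
    refine MemLp.of_le_mul (c := C ^ n * 2 ^ n) hg ?_ (Filter.Eventually.of_forall fun η => ?_)
    · exact (Continuous.aestronglyMeasurable (by fun_prop)).mul (hg.bornJordanKernel_mul n).1
    · have := norm_bornJordanKernel_mul_le n η
      rw [hMdef]
      simp only [norm_mul, Complex.norm_real, norm_pow, Real.norm_eq_abs]
      rw [abs_of_pos hC, abs_of_pos (by positivity : 0 < 1 + |inner ℝ η.fst η.snd|)]
      calc _ = C ^ n * (‖bornJordanKernel n η‖ * (1 + |inner ℝ η.fst η.snd|) ^ n) * ‖g η‖ := by ring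
        _ ≤ _ := by gcongr
  refine ⟨_, hb, hbc, ?_, _, hΓ, _, isGivenBy_fourier_smulLeftCLM (hg.bornJordanKernel_mul n) φ, ?_⟩
  · simp [b.one_of_mem_closedBall (Metric.mem_closedBall_self b.rIn_pos.le)]
  · refine memLp_correlation_weight hΓ.1.measurableSet (hg.bornJordanKernel_mul n).1 hM
      (𝓕 φ).continuous ?_ K.continuous K.integrable fun ξ hξ η => ?_
    · refine Complex.continuous_ofReal.comp (Continuous.rpow_const (by fun_prop) fun x => ?_)
      exact Or.inl (by positivity)
    · have h := pow_le_pow_left₀ (by positivity) (one_add_norm_sq_le hε0 hξ η) n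
      rw [mul_div_cancel_left₀ _ (two_ne_zero), Real.rpow_natCast, hK, hMdef]
      simp only [norm_mul, Complex.norm_real, norm_pow, Real.norm_eq_abs]
      rw [abs_of_pos hC, abs_of_pos (by positivity : 0 < 1 + |inner ℝ η.fst η.snd|),
        abs_of_pos (by positivity : 0 < 1 + ‖ξ‖ ^ 2), abs_of_pos (by positivity : 0 < 1 + ‖ξ + η‖ ^ 2)]
      rw [mul_pow, mul_pow] at h
      calc _ ≤ ‖bornJordanKernel n η‖ * ‖g η‖ * ‖𝓕 φ (ξ + η)‖ * _ :=
            mul_le_mul_of_nonneg_left h (by positivity)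
        _ = _ := by ring

end BornJordan

theorem corollary2 (d n : ℕ) (f : Config d → ℂ) (hf : MemLp f 2 volume) :
    MemLp (wigner f) 2 volume ∧
    (∃! Q : 𝓢'(Phase d, ℂ), IsBornJordanDistribution n f Q) ∧
    ∀ Q : 𝓢'(Phase d, ℂ), IsBornJordanDistribution n f Q →
      ∀ z ζ : Phase d, inner ℝ ζ.fst ζ.snd ≠ 0 →
        (z, ζ) ∉ sobolevWavefrontSet (2 * n : ℝ) Q := by
  have hW := memLp_wigner hf
  have hQ := isConvolution_bornJordan n hW
  -- `IsConvolution` prescribes the value of `Q` on every Schwartz function.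
  have huniq : ∀ Q : 𝓢'(Phase d, ℂ), IsBornJordanDistribution n f Q → Q = _ := fun Q h => by
    ext φ
    exact (h φ).2.trans (hQ φ).2.symm
  refine ⟨hW, ⟨_, hQ, huniq⟩, fun Q h z ζ hζ hmem => hmem.2 ?_⟩
  rw [huniq Q h]
  exact hasSobolevRegularityAt_bornJordan n (Lp.memLp _) z hζ
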